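/- Let $k\ge 2$ be an integer. Let $F(\rho,\sigma)=\left(\operatorname{Tr}\sqrt{\sqrt{\rho}\,\sigma\sqrt{\rho}}\right)^2$ be the (squared) Uhlmann fidelity of density matrices on a finite-dimensional complex Hilbert space; all pure states $|\psi\rangle$ are unit vectors. Entanglement. Consider finitely many parties with finite-dimensional Hilbert spaces $\mathcal H_1,\dots,\mathcal H_N$. A pure state of $\mathcal H_1\otimes\cdots\otimes\mathcal H_N$ is called $m$-producible if, for some partition of the set of parties into blocks of at most $m$ parties each, it is a tensor product of pure states of the blocks; a mixed state is $m$-producible if it is a finite convex combination of projectors $|\psi\rangle\langle\psi|$ onto $m$-producible pure states. Let $\mathcal P^{(m)}$ be the set of $m$-producible states. Put $$E_G^{(k)}(|\psi\rangle)=\inf_{|\varsigma\rangle\ (k-1)\text{-producible}}\left(1-|\langle\varsigma|\psi\rangle|^2\right),\qquad E_G^{(k)}(\rho)=\inf\sum_i p_i\,E_G^{(k)}(|\psi_i\rangle),$$ where the second infimum is over all finite decompositions $\rho=\sum_i p_i|\psi_i\rangle\langle\psi_i|$ into pure states with $p_i\ge 0$, $\sum_i p_i=1$. Then for every density matrix $\rho$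 on $\mathcal H_1\otimes\cdots\otimes\mathcal H_N$, $$E_G^{(k)}(\rho)=\inf_{\varsigma\in\mathcal P^{(k-1)}}\left(1-F(\rho,\varsigma)\right).$$ Coherence. Fix an orthonormal basis of a finite-dimensional Hilbert space $\mathcal H$. The coherence rank of a pure state is the number of its nonzero coefficients in this basis, and the coherence number of a density matrix is the minimum, over all its finite pure-state decompositions, of the largest coherence rank of a pure state in the decomposition. Let $\mathcal I^{(m)}$ be the set of density matrices with coherence number at most $m$. Put $$C_G^{(k)}(|\psi\rangle)=\inf_{|\sigma\rangle\text{ of coherence rank}\le k-1}\left(1-|\langle\sigma|\psi\rangle|^2\right),\qquad C_G^{(k)}(\rho)=\inf\sum_i p_i\,C_G^{(k)}(|\psi_i\rangle),$$ the second infimum again over all finite pure-state decompositions of $\rho$. Then for every density matrix $\rho$ on $\mathcal H$, $$C_G^{(k)}(\rho)=\inf_{\sigma\in\mathcal I^{(k-1)}}\left(1-F(\rho,\sigma)\right).$$ -/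

import Mathlib

open scoped MatrixOrder ComplexOrder

noncomputable section

namespace QuantumResource

/-! ### States, pure-state decompositions, fidelity

A finite-dimensional quantum system with a chosen orthonormal basis indexed by `n` has Hilbert space
`EuclideanSpace ℂ n`; pure states are unit vectors, mixed states are density matrices. -/

section States

variable {n : Type*} [Fintype n]

/-- Density matrices: positive semidefinite with trace one. -/
def IsState (ρ : Matrix n n ℂ) : Prop :=
  ρ.PosSemidef ∧ ρ.trace = 1

/-- The rank-one operator `|ψ⟩⟨ψ|`. -/
def ketbra (ψ : EuclideanSpace ℂ n) : Matrix n n ℂ :=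
  Matrix.of fun i j => ψ i * star (ψ j)

/-- `ρ = ∑ i, p i |ψ i⟩⟨ψ i|` is a finite convex decomposition of `ρ` into pure states. -/
structure IsPureDecomposition (ρ : Matrix n n ℂ) {m : ℕ} (p : Fin m → ℝ)
    (ψ : Fin m → EuclideanSpace ℂ n) : Prop where
  nonneg : ∀ i, 0 ≤ p i
  sum_eq_one : ∑ i, p i = 1
  norm_eq_one : ∀ i, ‖ψ i‖ = 1
  sum_eq : ∑ i, (p i : ℂ) • ketbra (ψ i) = ρ

/-- The (squared) fidelity `|⟨σ|ψ⟩|²` of two pure states. -/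
def pureFidelity (σ ψ : EuclideanSpace ℂ n) : ℝ :=
  ‖(inner ℂ σ ψ : ℂ)‖ ^ 2

/-- The (squared) Uhlmann fidelity `(Tr √(√ρ σ √ρ))²`. The square roots are those of positive
semidefinite matrices, so the trace is a nonnegative real. -/
def fidelity [DecidableEq n] (ρ σ : Matrix n n ℂ) : ℝ :=
  (CFC.sqrt (CFC.sqrt ρ * σ * CFC.sqrt ρ)).trace.re ^ 2

/-- The convex roof of a function on pure states: the infimum of its average over all pure-state
decompositions of `ρ`. -/
def convexRoof (f : EuclideanSpace ℂ n → ℝ) (ρ : Matrix n n ℂ) : ℝ :=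
  sInf {x | ∃ (m : ℕ) (p : Fin m → ℝ) (ψ : Fin m → EuclideanSpace ℂ n),
    IsPureDecomposition ρ p ψ ∧ x = ∑ i, p i * f (ψ i)}

end States

/-! ### Producibility and multipartite entanglement

The parties are indexed by `ι`, and party `i` has Hilbert space `EuclideanSpace ℂ (d i)`; the
tensor product of these spaces is `EuclideanSpace ℂ (∀ i, d i)`, with the product basis. -/

section Entanglement

variable {ι : Type*} [Fintype ι] [DecidableEq ι] {d : ι → Type*} [∀ i, Fintype (d i)]

/-- A pure state is `k`-producible if, for some partition of the parties into blocks of at most `k`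
parties, it is a tensor product of pure states of the blocks. -/
def IsProduciblePure (k : ℕ) (ψ : EuclideanSpace ℂ (∀ i, d i)) : Prop :=
  ∃ P : Finpartition (Finset.univ : Finset ι),
    (∀ B ∈ P.parts, B.card ≤ k) ∧
    ∃ φ : ∀ B : Finset ι, EuclideanSpace ℂ (∀ i : B, d i),
      (∀ B ∈ P.parts, ‖φ B‖ = 1) ∧
      ∀ x : ∀ i, d i, ψ x = ∏ B ∈ P.parts, φ B (fun i => x i)

/-- The set of `k`-producible states: convex combinations of `k`-producible pure states. -/
def producible (k : ℕ) : Set (Matrix (∀ i, d i) (∀ i, d i) ℂ) :=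
  {ρ | ∃ (m : ℕ) (p : Fin m → ℝ) (ψ : Fin m → EuclideanSpace ℂ (∀ i, d i)),
    IsPureDecomposition ρ p ψ ∧ ∀ i, IsProduciblePure k (ψ i)}

/-- Geometric measure of `k`-partite entanglement of a pure state. -/
def geomEntPure (k : ℕ) (ψ : EuclideanSpace ℂ (∀ i, d i)) : ℝ :=
  sInf {x | ∃ ς : EuclideanSpace ℂ (∀ i, d i),
    ‖ς‖ = 1 ∧ IsProduciblePure (k - 1) ς ∧ x = 1 - pureFidelity ς ψ}

/-- Geometric measure of `k`-partite entanglement of a mixed state. -/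
def geomEnt (k : ℕ) (ρ : Matrix (∀ i, d i) (∀ i, d i) ℂ) : ℝ :=
  convexRoof (geomEntPure k) ρ

end Entanglement

/-! ### Multilevel coherence in the basis indexed by `n` -/

section Coherence

variable {n : Type*} [Fintype n]

/-- The coherence rank: the number of nonzero coefficients in the reference basis. -/
def coherenceRank (ψ : EuclideanSpace ℂ n) : ℕ :=
  {i | ψ i ≠ 0}.ncard

/-- The coherence number: the minimum, over pure-state decompositions, of the maximal coherence
rank that occurs. -/
def coherenceNumber (ρ : Matrix n n ℂ) : ℕ :=
  sInf {r | ∃ (m : ℕ) (p : Fin m → ℝ) (ψ : Fin m → EuclideanSpace ℂ n),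
    IsPureDecomposition ρ p ψ ∧ r = Finset.univ.sup fun i => coherenceRank (ψ i)}

/-- The set of states that are at most `k`-coherent. -/
def atMostCoherent (k : ℕ) : Set (Matrix n n ℂ) :=
  {ρ | IsState ρ ∧ coherenceNumber ρ ≤ k}

/-- Geometric measure of `k`-coherence of a pure state. -/
def geomCohPure (k : ℕ) (ψ : EuclideanSpace ℂ n) : ℝ :=
  sInf {x | ∃ σ : EuclideanSpace ℂ n,
    ‖σ‖ = 1 ∧ coherenceRank σ ≤ k - 1 ∧ x = 1 - pureFidelity σ ψ}

/-- Geometric measure of `k`-coherence of a mixed state. -/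
def geomCoh (k : ℕ) (ρ : Matrix n n ℂ) : ℝ :=
  convexRoof (geomCohPure k) ρ

end Coherence

end QuantumResource

end

noncomputable section

namespace QuantumResource

open Matrix

variable {n κ : Type*} [Fintype n] [Fintype κ]

/-! Both claims are one statement about a nonempty set `S` of unit vectors
(`convexRoof_pureDistance`). A factorization ρ = AAᴴ is a purification of ρ, and its columns are the
weighted vectors of a pure-state decomposition. Uhlmann's theorem describes the fidelity by overlaps
|Tr AᴴB|² of such factorizations. Given a decomposition (pᵢ, ψᵢ) and sᵢ in `S`, mixing the sᵢ with
weights proportional to pᵢ|⟨sᵢ|ψᵢ⟩|² gives σ with F(ρ,σ) ≥ ∑ pᵢ|⟨sᵢ|ψᵢ⟩|²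
(`exists_mixture_le_fidelity`). Conversely, for a mixture σ of vectors of `S`, an optimal A yields a
decomposition of ρ, and Cauchy–Schwarz against the weights of σ bounds F(ρ,σ) by its average pure
fidelity (`exists_decomposition_le`). -/

theorem trace_conjTranspose_mul (A B : Matrix n κ ℂ) :
    (Aᴴ * B).trace = ∑ c, inner ℂ (WithLp.toLp 2 fun i => A i c) (WithLp.toLp 2 fun i => B i c) := by
  simp [Matrix.trace, Matrix.mul_apply, PiLp.inner_apply, mul_comm]

/-- Cauchy–Schwarz for the Hilbert–Schmidt inner product. -/
theorem norm_trace_conjTranspose_mul_sq_le (A B : Matrix n κ ℂ) :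
    ‖(Aᴴ * B).trace‖ ^ 2 ≤ (Aᴴ * A).trace.re * (Bᴴ * B).trace.re := by
  have h (A B : Matrix n κ ℂ) : (Aᴴ * B).trace =
      inner ℂ (WithLp.toLp 2 fun x : n × κ => A x.1 x.2) (WithLp.toLp 2 fun x : n × κ => B x.1 x.2) := by
    simp only [Matrix.trace, Matrix.mul_apply, PiLp.inner_apply, diag_apply, conjTranspose_apply]
    rw [Fintype.sum_prod_type_right]
    simp [mul_comm]
  rw [h A B, h A A, h B B, inner_self_eq_norm_sq_to_K, inner_self_eq_norm_sq_to_K]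
  simp only [Complex.coe_algebraMap, ← Complex.ofReal_pow, Complex.ofReal_re]
  rw [← mul_pow]
  gcongr
  exact norm_inner_le_norm _ _

/-! ### Polar decomposition and Uhlmann's theorem -/

section

variable [DecidableEq n]

theorem isHermitian_sqrt (M : Matrix n n ℂ) : (CFC.sqrt M)ᴴ = CFC.sqrt M :=
  (CFC.sqrt_nonneg M).isSelfAdjoint

/-- A positive semidefinite matrix has a commuting Hermitian pseudo-inverse. -/
theorem exists_pseudoInverse {R : Matrix n n ℂ} (hR : Rᴴ = R) :
    ∃ Q : Matrix n n ℂ, Qᴴ = Q ∧ Q * R = R * Q ∧ R * Q * R = R ∧ Q * R * Q = Q := by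
  have hsa : IsSelfAdjoint R := hR
  have hc (f : ℝ → ℝ) : ContinuousOn f (spectrum ℝ R) :=
    (Matrix.finite_real_spectrum (A := R)).continuousOn f
  have hid : cfc (fun x : ℝ => x) R = R := cfc_id' ℝ R
  -- Since 0⁻¹ = 0, inversion on the spectrum kills the kernel of R.
  refine ⟨cfc (fun x : ℝ => x⁻¹) R, cfc_predicate (fun x : ℝ => x⁻¹) R, ?_, ?_, ?_⟩
  · have h := (cfc_commute_cfc (fun x : ℝ => x⁻¹) (fun x : ℝ => x) R).eq
    rwa [hid] at h
  · have h : cfc (fun x : ℝ => x * x⁻¹ * x) R = R := by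
      conv_rhs => rw [← hid]
      congr 1
      funext x
      by_cases hx : x = 0 <;> simp [hx]
    rw [cfc_mul _ _ R (hc _) (hc _), cfc_mul _ _ R (hc _) (hc _), hid] at h
    exact h
  · have h : cfc (fun x : ℝ => x⁻¹ * x * x⁻¹) R = cfc (fun x : ℝ => x⁻¹) R := by
      congr 1
      funext x
      by_cases hx : x = 0 <;> simp [hx]
    rw [cfc_mul _ _ R (hc _) (hc _), cfc_mul _ _ R (hc _) (hc _), hid] at h
    exact h

/-- Polar decomposition with a partial isometry. -/
theorem exists_polar (A : Matrix n κ ℂ) :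
    ∃ W : Matrix n κ ℂ, A = CFC.sqrt (A * Aᴴ) * W ∧ (1 - W * Wᴴ).PosSemidef ∧
      CFC.sqrt (A * Aᴴ) * (W * Wᴴ) = CFC.sqrt (A * Aᴴ) := by
  classical
  have hRR : CFC.sqrt (A * Aᴴ) * CFC.sqrt (A * Aᴴ) = A * Aᴴ :=
    CFC.sqrt_mul_sqrt_self _ (Matrix.posSemidef_self_mul_conjTranspose A).nonneg
  have hR := isHermitian_sqrt (A * Aᴴ)
  generalize CFC.sqrt (A * Aᴴ) = R at hRR hR
  obtain ⟨Q, hQ, hc, hRQR, hQRQ⟩ := exists_pseudoInverse hR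
  have hW : (Q * A) * (Q * A)ᴴ = Q * R := by
    rw [conjTranspose_mul, hQ, Matrix.mul_assoc, ← Matrix.mul_assoc A, ← hRR, Matrix.mul_assoc R,
      ← hc, ← Matrix.mul_assoc R, hRQR]
  -- By `hW`, WWᴴ = QR, the orthogonal projection onto the range of R.
  refine ⟨Q * A, ?_, ?_, ?_⟩
  · have h : ((1 - R * Q) * A) * ((1 - R * Q) * A)ᴴ = 0 := by
      rw [conjTranspose_mul, Matrix.mul_assoc, ← Matrix.mul_assoc A, ← hRR, ← Matrix.mul_assoc,
        ← Matrix.mul_assoc, Matrix.sub_mul, hRQR]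
      simp
    rw [Matrix.self_mul_conjTranspose_eq_zero, Matrix.sub_mul, Matrix.one_mul, sub_eq_zero] at h
    rw [← Matrix.mul_assoc]
    exact h
  · have h : (1 - Q * R)ᴴ * (1 - Q * R) = 1 - Q * R := by
      rw [conjTranspose_sub, conjTranspose_mul, hQ, hR, ← hc, conjTranspose_one, Matrix.sub_mul,
        Matrix.mul_sub (Q * R), ← Matrix.mul_assoc (Q * R), hQRQ]
      simp
    rw [hW, ← h]
    exact Matrix.posSemidef_conjTranspose_mul_self _
  · rw [hW, ← Matrix.mul_assoc, hRQR]

/-- Contraction bound. -/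
theorem trace_sandwich_le {T : Matrix n n ℂ} (hT : T.PosSemidef) {W : Matrix n κ ℂ}
    (hW : (1 - W * Wᴴ).PosSemidef) : (Wᴴ * T * W).trace.re ≤ T.trace.re := by
  classical
  have hTT := CFC.sqrt_mul_sqrt_self T hT.nonneg
  have hS := isHermitian_sqrt T
  generalize CFC.sqrt T = S at hTT hS
  have h : 0 ≤ (S * (1 - W * Wᴴ) * Sᴴ).trace := (hW.mul_mul_conjTranspose_same S).trace_nonneg
  have e : (S * (1 - W * Wᴴ) * Sᴴ).trace = T.trace - (Wᴴ * T * W).trace := by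
    rw [hS, Matrix.mul_sub, Matrix.sub_mul, Matrix.mul_one, hTT, trace_sub]
    congr 1
    rw [Matrix.trace_mul_comm, ← Matrix.mul_assoc, hTT, Matrix.mul_assoc, ← Matrix.mul_assoc T,
      Matrix.trace_mul_comm]
  rw [e] at h
  have := (Complex.le_def.1 h).1
  simp at this
  exact this

/-- Splitting T as √T√T, Cauchy–Schwarz reduces this to the diagonal cases V = W. -/
theorem norm_trace_le_of_contraction {T : Matrix n n ℂ} (hT : T.PosSemidef) {V W : Matrix n κ ℂ}
    (hV : (1 - V * Vᴴ).PosSemidef) (hW : (1 - W * Wᴴ).PosSemidef) :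
    ‖(Wᴴ * T * V).trace‖ ≤ T.trace.re := by
  have hTT := CFC.sqrt_mul_sqrt_self T hT.nonneg
  have hS := isHermitian_sqrt T
  have h := norm_trace_conjTranspose_mul_sq_le (CFC.sqrt T * W) (CFC.sqrt T * V)
  have e (X Y : Matrix n κ ℂ) : (CFC.sqrt T * X)ᴴ * (CFC.sqrt T * Y) = Xᴴ * T * Y := by
    rw [conjTranspose_mul, hS, Matrix.mul_assoc, ← Matrix.mul_assoc (CFC.sqrt T), hTT,
      ← Matrix.mul_assoc]
  rw [e, e, e] at h
  have h0 : 0 ≤ T.trace.re := (Complex.le_def.1 hT.trace_nonneg).1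
  have h1 : 0 ≤ (Vᴴ * T * V).trace.re :=
    (Complex.le_def.1 (hT.conjTranspose_mul_mul_same V).trace_nonneg).1
  refine (sq_le_sq₀ (norm_nonneg _) h0).1 ?_
  exact h.trans ((mul_le_mul (trace_sandwich_le hT hW) (trace_sandwich_le hT hV) h1 h0).trans_eq
    (sq _).symm)

theorem sqrt_mul_self_conjTranspose (ρ : Matrix n n ℂ) (B : Matrix n κ ℂ) :
    (CFC.sqrt ρ * B) * (CFC.sqrt ρ * B)ᴴ = CFC.sqrt ρ * (B * Bᴴ) * CFC.sqrt ρ := by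
  rw [conjTranspose_mul, isHermitian_sqrt]
  simp only [Matrix.mul_assoc]

/-- Any two purifications overlap by at most the fidelity. -/
theorem norm_trace_sq_le_fidelity {ρ σ : Matrix n n ℂ} {A B : Matrix n κ ℂ} (hA : A * Aᴴ = ρ)
    (hB : B * Bᴴ = σ) : ‖(Aᴴ * B).trace‖ ^ 2 ≤ fidelity ρ σ := by
  obtain ⟨W, hAW, hW, -⟩ := exists_polar A
  obtain ⟨V, hV', hV, -⟩ := exists_polar (CFC.sqrt ρ * B)
  rw [sqrt_mul_self_conjTranspose, hB] at hV'
  rw [hA] at hAW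
  have h : Aᴴ = Wᴴ * CFC.sqrt ρ := by
    rw [hAW, conjTranspose_mul, isHermitian_sqrt]
  have e : Aᴴ * B = Wᴴ * CFC.sqrt (CFC.sqrt ρ * σ * CFC.sqrt ρ) * V := by
    rw [h, Matrix.mul_assoc, hV', ← Matrix.mul_assoc]
  have hT : (CFC.sqrt (CFC.sqrt ρ * σ * CFC.sqrt ρ)).PosSemidef :=
    Matrix.nonneg_iff_posSemidef.1 (CFC.sqrt_nonneg _)
  have hle := norm_trace_le_of_contraction hT hV hW
  rw [e]
  unfold fidelity
  exact pow_le_pow_left₀ (norm_nonneg _) hle 2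

/-- Uhlmann's theorem: some purification of `ρ` attains the fidelity. -/
theorem exists_purification {ρ : Matrix n n ℂ} (hρ : ρ.PosSemidef) (B : Matrix n κ ℂ) :
    ∃ (A : Matrix n κ ℂ) (A' : Matrix n n ℂ), A * Aᴴ + A' * A'ᴴ = ρ ∧
      ‖(Aᴴ * B).trace‖ ^ 2 = fidelity ρ (B * Bᴴ) := by
  obtain ⟨W, hC, hW, hT⟩ := exists_polar (CFC.sqrt ρ * B)
  rw [sqrt_mul_self_conjTranspose] at hC hT
  have hr : (CFC.sqrt ρ * (1 - W * Wᴴ) * CFC.sqrt ρ).PosSemidef := by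
    have := hW.mul_mul_conjTranspose_same (CFC.sqrt ρ)
    rwa [isHermitian_sqrt] at this
  -- W is only a partial isometry, so √ρ W may account for only part of ρ; A' is a square root of
  -- the remainder.
  refine ⟨CFC.sqrt ρ * W, CFC.sqrt (CFC.sqrt ρ * (1 - W * Wᴴ) * CFC.sqrt ρ), ?_, ?_⟩
  · rw [sqrt_mul_self_conjTranspose, isHermitian_sqrt, CFC.sqrt_mul_sqrt_self _ hr.nonneg,
      ← Matrix.add_mul, ← Matrix.mul_add, add_sub_cancel, Matrix.mul_one,
      CFC.sqrt_mul_sqrt_self _ hρ.nonneg]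
  · rw [conjTranspose_mul, isHermitian_sqrt, Matrix.mul_assoc, hC, Matrix.trace_mul_comm,
      Matrix.mul_assoc, hT, fidelity]
    have h : 0 ≤ (CFC.sqrt (CFC.sqrt ρ * (B * Bᴴ) * CFC.sqrt ρ)).trace :=
      (Matrix.nonneg_iff_posSemidef.1 (CFC.sqrt_nonneg _)).trace_nonneg
    congr 1
    conv_lhs => rw [Complex.eq_re_of_ofReal_le h]
    rw [Complex.norm_real, Real.norm_of_nonneg (Complex.le_def.1 h).1]

end

/-! ### Convex roofs and fidelity distance for a general set of pure states -/

section ConvexRoof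

/-- The distance in pure fidelity from `ψ` to the unit vectors satisfying `S`. -/
def pureDistance (S : EuclideanSpace ℂ n → Prop) (ψ : EuclideanSpace ℂ n) : ℝ :=
  sInf {x | ∃ s : EuclideanSpace ℂ n, ‖s‖ = 1 ∧ S s ∧ x = 1 - pureFidelity s ψ}

theorem pureFidelity_le_one {s ψ : EuclideanSpace ℂ n} (hs : ‖s‖ = 1) (hψ : ‖ψ‖ = 1) :
    pureFidelity s ψ ≤ 1 := by
  have h := norm_inner_le_norm (𝕜 := ℂ) s ψ
  rw [hs, hψ, one_mul] at h
  exact pow_le_one₀ (norm_nonneg _) h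

theorem pureDistance_nonneg (S : EuclideanSpace ℂ n → Prop) {ψ : EuclideanSpace ℂ n}
    (hψ : ‖ψ‖ = 1) : 0 ≤ pureDistance S ψ := by
  refine Real.sInf_nonneg ?_
  rintro _ ⟨s, hs, -, rfl⟩
  exact sub_nonneg.2 (pureFidelity_le_one hs hψ)

theorem pureDistance_le {S : EuclideanSpace ℂ n → Prop} {s ψ : EuclideanSpace ℂ n}
    (hψ : ‖ψ‖ = 1) (hs : ‖s‖ = 1) (hS : S s) : pureDistance S ψ ≤ 1 - pureFidelity s ψ := by
  refine csInf_le ⟨0, ?_⟩ ⟨s, hs, hS, rfl⟩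
  rintro _ ⟨t, ht, -, rfl⟩
  exact sub_nonneg.2 (pureFidelity_le_one ht hψ)

theorem exists_lt_pureDistance_add {S : EuclideanSpace ℂ n → Prop} (hne : ∃ s, ‖s‖ = 1 ∧ S s)
    (ψ : EuclideanSpace ℂ n) {ε : ℝ} (hε : 0 < ε) :
    ∃ s, ‖s‖ = 1 ∧ S s ∧ 1 - pureFidelity s ψ < pureDistance S ψ + ε := by
  obtain ⟨s₀, h₀, hS₀⟩ := hne
  have hne' : {x | ∃ s : EuclideanSpace ℂ n, ‖s‖ = 1 ∧ S s ∧ x = 1 - pureFidelity s ψ}.Nonempty :=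
    ⟨_, s₀, h₀, hS₀, rfl⟩
  obtain ⟨_, ⟨s, hs, hS, rfl⟩, h⟩ :=
    exists_lt_of_csInf_lt hne' (lt_add_of_pos_right (pureDistance S ψ) hε)
  exact ⟨s, hs, hS, h⟩

/-- The matrix whose columns are the vectors `b c • s c`. -/
def columns (b : κ → ℂ) (s : κ → EuclideanSpace ℂ n) : Matrix n κ ℂ :=
  Matrix.of fun i c => b c * s c i

theorem columns_mul_conjTranspose {n κ : Type*} [Fintype κ] (b : κ → ℂ) (s : κ → EuclideanSpace ℂ n) :
    columns b s * (columns b s)ᴴ = ∑ c, ((‖b c‖ ^ 2 : ℝ) : ℂ) • ketbra (s c) := by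
  ext i j
  simp only [columns, Matrix.mul_apply, conjTranspose_apply, of_apply, Matrix.sum_apply,
    Matrix.smul_apply, ketbra, smul_eq_mul, star_mul']
  refine Finset.sum_congr rfl fun c _ => ?_
  have h : b c * star (b c) = ((‖b c‖ ^ 2 : ℝ) : ℂ) := by
    rw [Complex.star_def, Complex.mul_conj, Complex.normSq_eq_norm_sq]
  rw [← h]
  ring

theorem trace_columns (a b : κ → ℂ) (s t : κ → EuclideanSpace ℂ n) :
    ((columns a s)ᴴ * columns b t).trace = ∑ c, star (a c) * b c * inner ℂ (s c) (t c) := by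
  rw [trace_conjTranspose_mul]
  refine Finset.sum_congr rfl fun c _ => ?_
  have h (a : κ → ℂ) (s : κ → EuclideanSpace ℂ n) :
      (WithLp.toLp 2 fun i => columns a s i c : EuclideanSpace ℂ n) = a c • s c := rfl
  rw [h, h, inner_smul_left, inner_smul_right, Complex.star_def, mul_assoc]

/-- Every matrix has its columns in polar form. -/
theorem exists_eq_columns {n κ : Type*} [Fintype n] [Nonempty n] (A : Matrix n κ ℂ) :
    ∃ (a : κ → ℝ) (ψ : κ → EuclideanSpace ℂ n), (∀ c, 0 ≤ a c) ∧ (∀ c, ‖ψ c‖ = 1) ∧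
      A = columns (fun c => (a c : ℂ)) ψ := by
  classical
  have h (v : EuclideanSpace ℂ n) : ∃ (r : ℝ) (u : EuclideanSpace ℂ n), 0 ≤ r ∧ ‖u‖ = 1 ∧
      v = (r : ℂ) • u := by
    by_cases hv : v = 0
    -- A zero column gets weight 0 and an arbitrary unit vector.
    · exact ⟨0, EuclideanSpace.single (Classical.arbitrary n) 1, le_rfl, by simp, by simp [hv]⟩
    · exact ⟨‖v‖, (‖v‖⁻¹ : ℂ) • v, norm_nonneg v, by simp [norm_smul, hv], by simp [smul_smul, hv]⟩
  choose r u hr hu hv using h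
  refine ⟨fun c => r (WithLp.toLp 2 fun i => A i c), fun c => u (WithLp.toLp 2 fun i => A i c),
    fun _ => hr _, fun _ => hu _, ?_⟩
  ext i c
  exact congrArg (fun v : EuclideanSpace ℂ n => v i) (hv (WithLp.toLp 2 fun i => A i c))

theorem trace_ketbra {ψ : EuclideanSpace ℂ n} (hψ : ‖ψ‖ = 1) : (ketbra ψ).trace = 1 := by
  have h := inner_self_eq_norm_sq_to_K (𝕜 := ℂ) ψ
  rw [hψ, PiLp.inner_apply] at h
  refine Eq.trans ?_ (h.trans (by simp))
  simp [Matrix.trace, ketbra, Complex.mul_conj, Complex.normSq_eq_norm_sq]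

theorem sum_eq_one_of_trace {p : κ → ℝ} {ψ : κ → EuclideanSpace ℂ n} (hψ : ∀ c, ‖ψ c‖ = 1)
    (h : (∑ c, (p c : ℂ) • ketbra (ψ c)).trace = 1) : ∑ c, p c = 1 := by
  simp only [Matrix.trace_sum, Matrix.trace_smul, trace_ketbra (hψ _), smul_eq_mul, mul_one] at h
  exact_mod_cast h

theorem IsState.nonempty {ρ : Matrix n n ℂ} (hρ : IsState ρ) : Nonempty n := by
  by_contra h
  rw [not_nonempty_iff] at h
  simpa [Matrix.trace] using hρ.2

/-- Decompositions may be indexed by any finite type. -/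
theorem exists_isPureDecomposition {ρ : Matrix n n ℂ} {p : κ → ℝ} {ψ : κ → EuclideanSpace ℂ n}
    (hp : ∀ c, 0 ≤ p c) (hψ : ∀ c, ‖ψ c‖ = 1) (h1 : ∑ c, p c = 1)
    (h : ∑ c, (p c : ℂ) • ketbra (ψ c) = ρ) :
    ∃ (m : ℕ) (e : Fin m ≃ κ), IsPureDecomposition ρ (p ∘ e) (ψ ∘ e) := by
  refine ⟨_, (Fintype.equivFin κ).symm, fun _ => hp _, ?_, fun _ => hψ _, ?_⟩
  · rw [← h1]
    exact Equiv.sum_comp (Fintype.equivFin κ).symm p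
  · rw [← h]
    exact Equiv.sum_comp (Fintype.equivFin κ).symm fun c => (p c : ℂ) • ketbra (ψ c)

theorem IsPureDecomposition.eq_columns {ρ : Matrix n n ℂ} {m : ℕ} {p : Fin m → ℝ}
    {ψ : Fin m → EuclideanSpace ℂ n} (h : IsPureDecomposition ρ p ψ) :
    columns (fun c => (√(p c) : ℂ)) ψ * (columns (fun c => (√(p c) : ℂ)) ψ)ᴴ = ρ := by
  rw [columns_mul_conjTranspose, ← h.sum_eq]
  refine Finset.sum_congr rfl fun c _ => ?_
  rw [Complex.norm_real, Real.norm_of_nonneg (Real.sqrt_nonneg _), Real.sq_sqrt (h.nonneg c)]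

variable [DecidableEq n]

theorem IsState.exists_isPureDecomposition {ρ : Matrix n n ℂ} (hρ : IsState ρ) :
    ∃ (m : ℕ) (p : Fin m → ℝ) (ψ : Fin m → EuclideanSpace ℂ n), IsPureDecomposition ρ p ψ := by
  have := hρ.nonempty
  obtain ⟨a, ψ, -, hψ, hA⟩ := exists_eq_columns (CFC.sqrt ρ)
  have h : ∑ c, ((‖(a c : ℂ)‖ ^ 2 : ℝ) : ℂ) • ketbra (ψ c) = ρ := by
    rw [← columns_mul_conjTranspose, ← hA, isHermitian_sqrt, CFC.sqrt_mul_sqrt_self _ hρ.1.nonneg]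
  obtain ⟨m, e, he⟩ := QuantumResource.exists_isPureDecomposition (fun c => by positivity) hψ
    (sum_eq_one_of_trace hψ (by rw [h, hρ.2])) h
  exact ⟨m, _, _, he⟩

/-- The convex hull of the projectors onto the unit vectors satisfying `S`. -/
def mixtures (S : EuclideanSpace ℂ n → Prop) : Set (Matrix n n ℂ) :=
  {ρ | ∃ (m : ℕ) (p : Fin m → ℝ) (ψ : Fin m → EuclideanSpace ℂ n),
    IsPureDecomposition ρ p ψ ∧ ∀ i, S (ψ i)}

theorem fidelity_nonneg (ρ σ : Matrix n n ℂ) : 0 ≤ fidelity ρ σ := sq_nonneg _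

/-- A decomposition of `ρ` is matched by a mixture at least as close to `ρ` in fidelity. -/
theorem exists_mixture_le_fidelity {S : EuclideanSpace ℂ n → Prop} {ρ : Matrix n n ℂ} {m : ℕ}
    {p : Fin m → ℝ} {ψ s : Fin m → EuclideanSpace ℂ n} (h : IsPureDecomposition ρ p ψ)
    (hs : ∀ i, ‖s i‖ = 1) (hS : ∀ i, S (s i)) :
    ∃ σ ∈ mixtures S, ∑ i, p i * pureFidelity (s i) (ψ i) ≤ fidelity ρ σ := by
  set N := ∑ i, p i * pureFidelity (s i) (ψ i) with hN
  have hterm (i) : 0 ≤ p i * pureFidelity (s i) (ψ i) := mul_nonneg (h.nonneg i) (sq_nonneg _)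
  have hN0 : 0 ≤ N := Finset.sum_nonneg fun i _ => hterm i
  -- When N = 0 the weights below cannot be normalized, but any mixture will do.
  rcases hN0.eq_or_lt with hN0 | hN0
  · exact ⟨∑ i, (p i : ℂ) • ketbra (s i), ⟨m, p, s, ⟨h.nonneg, h.sum_eq_one, hs, rfl⟩, hS⟩,
      hN0 ▸ fidelity_nonneg _ _⟩
  -- The phase of ⟨sᵢ|ψᵢ⟩ makes every term of the overlap nonnegative, and the terms add up to √N.
  set b : Fin m → ℂ := fun i => (√(p i) / √N : ℝ) * inner ℂ (s i) (ψ i) with hb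
  have hb2 (i) : ‖b i‖ ^ 2 = p i * pureFidelity (s i) (ψ i) / N := by
    rw [hb, norm_mul, mul_pow, Complex.norm_real, Real.norm_of_nonneg (by positivity), div_pow,
      Real.sq_sqrt (h.nonneg i), Real.sq_sqrt hN0.le, pureFidelity]
    ring
  refine ⟨columns b s * (columns b s)ᴴ, ⟨m, fun i => ‖b i‖ ^ 2, s,
    ⟨fun i => by positivity, ?_, hs, (columns_mul_conjTranspose b s).symm⟩, hS⟩, ?_⟩
  · simp only [hb2, ← Finset.sum_div, ← hN]
    exact div_self hN0.ne'
  · have ht := norm_trace_sq_le_fidelity h.eq_columns (B := columns b s) rfl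
    rw [trace_columns] at ht
    refine le_trans (le_of_eq ?_) ht
    have e : ∑ c, star (√(p c) : ℂ) * b c * inner ℂ (ψ c) (s c) = ((√N : ℝ) : ℂ) := by
      have hc (c) : star (√(p c) : ℂ) * b c * inner ℂ (ψ c) (s c) =
          ((p c * pureFidelity (s c) (ψ c) / √N : ℝ) : ℂ) := by
        have h1 : (inner ℂ (s c) (ψ c) : ℂ) * inner ℂ (ψ c) (s c) =
            ((pureFidelity (s c) (ψ c) : ℝ) : ℂ) := by
          rw [← inner_conj_symm (ψ c) (s c), Complex.mul_conj, Complex.normSq_eq_norm_sq,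
            pureFidelity]
        have h2 : (√(p c) : ℂ) * √(p c) = p c := by
          rw [← Complex.ofReal_mul, Real.mul_self_sqrt (h.nonneg c)]
        rw [hb, Complex.star_def, Complex.conj_ofReal]
        push_cast
        rw [← h1, ← h2]
        ring
      simp only [hc]
      rw [← Complex.ofReal_sum, ← Finset.sum_div, ← hN, Real.div_sqrt]
    rw [e, Complex.norm_real, Real.norm_of_nonneg (Real.sqrt_nonneg _), Real.sq_sqrt hN0.le]

/-- A mixture is matched by a decomposition of `ρ` at least as close in average. -/
theorem exists_decomposition_le {S : EuclideanSpace ℂ n → Prop} {ρ σ : Matrix n n ℂ}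
    (hρ : IsState ρ) (hσ : σ ∈ mixtures S) :
    ∃ (m : ℕ) (p : Fin m → ℝ) (ψ : Fin m → EuclideanSpace ℂ n), IsPureDecomposition ρ p ψ ∧
      ∑ i, p i * pureDistance S (ψ i) ≤ 1 - fidelity ρ σ := by
  have := hρ.nonempty
  obtain ⟨m, q, s, h, hS⟩ := hσ
  have hm : Nonempty (Fin m) := by
    by_contra hm
    rw [not_nonempty_iff] at hm
    simpa using h.sum_eq_one
  obtain ⟨A, A', hA, hF⟩ := exists_purification hρ.1 (columns (fun c => (√(q c) : ℂ)) s)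
  rw [h.eq_columns] at hF
  obtain ⟨a, ψ, -, hψ, rfl⟩ := exists_eq_columns A
  obtain ⟨a', ψ', -, hψ', rfl⟩ := exists_eq_columns A'
  -- The columns of A are paired with the sᶜ; those of A' only complete the decomposition of ρ.
  set p : Fin m ⊕ n → ℝ := Sum.elim (fun c => a c ^ 2) (fun c => a' c ^ 2) with hp
  have hsum : ∑ c, (p c : ℂ) • ketbra (Sum.elim ψ ψ' c) = ρ := by
    rw [← hA, columns_mul_conjTranspose, columns_mul_conjTranspose, Fintype.sum_sum_type]
    simp [hp]
  have hp0 (c) : 0 ≤ p c := by rcases c with c | c <;> exact sq_nonneg _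
  have hψψ (c) : ‖Sum.elim ψ ψ' c‖ = 1 := by
    rcases c with c | c
    · exact hψ c
    · exact hψ' c
  have hp1 := sum_eq_one_of_trace hψψ (by rw [hsum, hρ.2])
  obtain ⟨M, e, he⟩ := QuantumResource.exists_isPureDecomposition hp0 hψψ hp1 hsum
  refine ⟨M, _, _, he, ?_⟩
  have hre := Equiv.sum_comp e fun c => p c * pureDistance S (Sum.elim ψ ψ' c)
  refine hre.le.trans ?_
  rw [trace_columns] at hF
  have hCS : fidelity ρ σ ≤ ∑ c, a c ^ 2 * pureFidelity (s c) (ψ c) := by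
    rw [← hF]
    have h1 : ‖∑ c, star (a c : ℂ) * (√(q c) : ℂ) * inner ℂ (ψ c) (s c)‖ ≤
        ∑ c, √(q c) * (|a c| * ‖(inner ℂ (s c) (ψ c) : ℂ)‖) := by
      refine (norm_sum_le _ _).trans (Finset.sum_le_sum fun c _ => le_of_eq ?_)
      rw [norm_mul, norm_mul, norm_star, Complex.norm_real, Complex.norm_real,
        Real.norm_of_nonneg (Real.sqrt_nonneg _), Real.norm_eq_abs, norm_inner_symm]
      ring
    -- Cauchy–Schwarz: the factor ∑ q = 1 drops out.
    refine (pow_le_pow_left₀ (norm_nonneg _) h1 2).trans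
      ((Finset.sum_mul_sq_le_sq_mul_sq _ _ _).trans (le_of_eq ?_))
    simp only [Real.sq_sqrt (h.nonneg _), h.sum_eq_one, one_mul, mul_pow, sq_abs, pureFidelity]
  have hle (c) : p c * pureDistance S (Sum.elim ψ ψ' c) ≤
      p c - Sum.elim (fun c => a c ^ 2 * pureFidelity (s c) (ψ c)) 0 c := by
    -- A leftover column is compared with an arbitrary s, since distance at most 1 suffices there.
    have hmul := mul_le_mul_of_nonneg_left (pureDistance_le (S := S) (hψψ c)
      (h.norm_eq_one (Sum.elim id (fun _ => hm.some) c)) (hS _)) (hp0 c)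
    refine hmul.trans ?_
    rcases c with c | c
    · simp [hp, mul_sub]
    · simpa [hp, pureFidelity] using mul_le_of_le_one_right (sq_nonneg (a' c))
        (sub_le_self (1 : ℝ) (sq_nonneg ‖(inner ℂ (s hm.some) (ψ' c) : ℂ)‖))
  refine (Finset.sum_le_sum fun c _ => hle c).trans ?_
  rw [Finset.sum_sub_distrib, hp1, Fintype.sum_sum_type]
  simp only [Sum.elim_inl, Sum.elim_inr, Pi.zero_apply, Finset.sum_const_zero, add_zero]
  exact sub_le_sub_left hCS 1

/-- The convex roof of the pure distance to `S` is the fidelity distance to mixtures of `S`. -/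
theorem convexRoof_pureDistance {S : EuclideanSpace ℂ n → Prop} (hne : ∃ s, ‖s‖ = 1 ∧ S s)
    {ρ : Matrix n n ℂ} (hρ : IsState ρ) :
    convexRoof (pureDistance S) ρ = sInf {x : ℝ | ∃ σ ∈ mixtures S, x = 1 - fidelity ρ σ} := by
  have hbdd : BddBelow {x | ∃ (m : ℕ) (p : Fin m → ℝ) (ψ : Fin m → EuclideanSpace ℂ n),
      IsPureDecomposition ρ p ψ ∧ x = ∑ i, p i * pureDistance S (ψ i)} := by
    refine ⟨0, ?_⟩
    rintro _ ⟨m, p, ψ, h, rfl⟩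
    exact Finset.sum_nonneg fun i _ =>
      mul_nonneg (h.nonneg i) (pureDistance_nonneg S (h.norm_eq_one i))
  have hle {σ} (hσ : σ ∈ mixtures S) : convexRoof (pureDistance S) ρ ≤ 1 - fidelity ρ σ := by
    obtain ⟨m, p, ψ, h, hm⟩ := exists_decomposition_le hρ hσ
    exact (csInf_le hbdd ⟨m, p, ψ, h, rfl⟩).trans hm
  apply le_antisymm
  · obtain ⟨s, hs, hS⟩ := hne
    refine le_csInf ⟨_, ketbra s, ⟨1, fun _ => 1, fun _ => s,
      ⟨by simp, by simp, fun _ => hs, by simp⟩, fun _ => hS⟩, rfl⟩ ?_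
    rintro _ ⟨σ, hσ, rfl⟩
    exact hle hσ
  · obtain ⟨m, p, ψ, h⟩ := hρ.exists_isPureDecomposition
    refine le_csInf ⟨_, m, p, ψ, h, rfl⟩ ?_
    clear! m
    rintro _ ⟨m, p, ψ, h, rfl⟩
    -- Near-optimal sᵢ suffice, so `S` need not be closed.
    refine le_of_forall_pos_le_add fun ε hε => ?_
    choose s hs hS hlt using fun i => exists_lt_pureDistance_add hne (ψ i) hε
    obtain ⟨σ, hσ, hF⟩ := exists_mixture_le_fidelity h hs hS
    have h1 : sInf {x : ℝ | ∃ σ ∈ mixtures S, x = 1 - fidelity ρ σ} ≤ 1 - fidelity ρ σ := by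
      refine csInf_le ⟨convexRoof (pureDistance S) ρ, ?_⟩ ⟨σ, hσ, rfl⟩
      rintro _ ⟨τ, hτ, rfl⟩
      exact hle hτ
    have h2 : ∑ i, p i * (1 - pureFidelity (s i) (ψ i)) ≤ ∑ i, p i * (pureDistance S (ψ i) + ε) :=
      Finset.sum_le_sum fun i _ => mul_le_mul_of_nonneg_left (hlt i).le (h.nonneg i)
    simp only [mul_sub, mul_add, mul_one, Finset.sum_sub_distrib, Finset.sum_add_distrib,
      ← Finset.sum_mul, h.sum_eq_one, one_mul] at h2
    linarith

end ConvexRoof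

/-! ### The coherence and producibility instances -/

theorem mem_atMostCoherent_iff [DecidableEq n] {k : ℕ} {σ : Matrix n n ℂ} :
    σ ∈ atMostCoherent k ↔ σ ∈ mixtures fun ψ : EuclideanSpace ℂ n => coherenceRank ψ ≤ k := by
  constructor
  · rintro ⟨hσ, hk⟩
    obtain ⟨m, p, ψ, h⟩ := hσ.exists_isPureDecomposition
    -- A state has some decomposition, so the minimum is attained rather than being the default 0 of
    -- an empty infimum.
    obtain ⟨m, p, ψ, h, hr⟩ := Nat.sInf_mem (s := {r | ∃ (m : ℕ) (p : Fin m → ℝ)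
      (ψ : Fin m → EuclideanSpace ℂ n), IsPureDecomposition σ p ψ ∧
        r = Finset.univ.sup fun i => coherenceRank (ψ i)}) ⟨_, m, p, ψ, h, rfl⟩
    refine ⟨m, p, ψ, h, fun i => le_trans ?_ hk⟩
    refine (Finset.le_sup (f := fun i => coherenceRank (ψ i)) (Finset.mem_univ i)).trans hr.ge
  · rintro ⟨m, p, ψ, h, hr⟩
    refine ⟨⟨?_, ?_⟩, le_trans (Nat.sInf_le ⟨m, p, ψ, h, rfl⟩) (Finset.sup_le fun i _ => hr i)⟩
    · rw [← h.eq_columns]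
      exact posSemidef_self_mul_conjTranspose _
    · rw [← h.sum_eq]
      simp only [Matrix.trace_sum, Matrix.trace_smul, trace_ketbra (h.norm_eq_one _), smul_eq_mul,
        mul_one]
      exact_mod_cast h.sum_eq_one

theorem exists_coherenceRank_le [DecidableEq n] [Nonempty n] {k : ℕ} (hk : 1 ≤ k) :
    ∃ s : EuclideanSpace ℂ n, ‖s‖ = 1 ∧ coherenceRank s ≤ k := by
  refine ⟨EuclideanSpace.single (Classical.arbitrary n) 1, by simp, le_trans ?_ hk⟩
  refine (Set.ncard_le_ncard (t := {Classical.arbitrary n}) (fun i hi => ?_)).trans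
    (Set.ncard_singleton _).le
  by_contra h
  exact hi (by simpa using h)

theorem exists_isProduciblePure {ι : Type*} [Fintype ι] [DecidableEq ι] {d : ι → Type*}
    [∀ i, Fintype (d i)] [∀ i, DecidableEq (d i)] (x₀ : ∀ i, d i) {k : ℕ} (hk : 1 ≤ k) :
    ∃ s : EuclideanSpace ℂ (∀ i, d i), ‖s‖ = 1 ∧ IsProduciblePure k s := by
  refine ⟨EuclideanSpace.single x₀ 1, by simp, ⊥, fun B hB => ?_,
    fun B => EuclideanSpace.single (fun i : B => x₀ i) 1, fun B _ => by simp, fun x => ?_⟩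
  · obtain ⟨i, -, rfl⟩ := Finpartition.mem_bot_iff.1 hB
    simpa using hk
  · by_cases hx : x = x₀
    · subst hx
      simp
    · obtain ⟨i, hi⟩ := Function.ne_iff.1 hx
      -- Off x₀, the factor of a party i where x and x₀ differ vanishes.
      rw [Finset.prod_eq_zero (i := {i}) (Finpartition.mem_bot_iff.2 ⟨i, Finset.mem_univ i, rfl⟩)]
      · simp [hx]
      · have : (fun j : ({i} : Finset ι) => x j) ≠ fun j : ({i} : Finset ι) => x₀ j :=
          fun h => hi (congrFun h ⟨i, Finset.mem_singleton_self i⟩)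
        simp [this]

end QuantumResource
end

theorem proposition2 (k : ℕ) (hk : 2 ≤ k) :
    (∀ (ι : Type*) [Fintype ι] [DecidableEq ι] (d : ι → Type*)
        [∀ i, Fintype (d i)] [∀ i, DecidableEq (d i)]
        (ρ : Matrix (∀ i, d i) (∀ i, d i) ℂ), QuantumResource.IsState ρ →
        QuantumResource.geomEnt k ρ =
          sInf {x : ℝ | ∃ ς ∈ QuantumResource.producible (d := d) (k - 1),
            x = 1 - QuantumResource.fidelity ρ ς}) ∧
    (∀ (n : Type*) [Fintype n] [DecidableEq n]
        (ρ : Matrix n n ℂ), QuantumResource.IsState ρ →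
        QuantumResource.geomCoh k ρ =
          sInf {x : ℝ | ∃ σ ∈ QuantumResource.atMostCoherent (n := n) (k - 1),
            x = 1 - QuantumResource.fidelity ρ σ}) := by
  -- This makes basis vectors admissible: they have coherence rank one and factor over singleton
  -- blocks.
  have hk1 : 1 ≤ k - 1 := Nat.le_sub_of_add_le hk
  constructor
  · intro ι _ _ d _ _ ρ hρ
    obtain ⟨x₀⟩ := hρ.nonempty
    -- Here `geomEntPure` and `producible` unfold to `pureDistance` and `mixtures`.
    exact QuantumResource.convexRoof_pureDistance
      (QuantumResource.exists_isProduciblePure x₀ hk1) hρ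
  · intro n _ _ ρ hρ
    have := hρ.nonempty
    simp only [QuantumResource.mem_atMostCoherent_iff]
    exact QuantumResource.convexRoof_pureDistance
      (QuantumResource.exists_coherenceRank_le hk1) hρ
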